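/- Let $\Theta\subset\mathbb{R}^m$ be compact and such that $\Theta\cap B(\theta,\varepsilon)$ has positive Lebesgue measure for every $\theta\in\Theta$ and $\varepsilon>0$. Let $\mathcal{Y}\subset\mathbb{R}^d$, let $P$ be a probability measure on $\mathcal{Y}$, let $\rho_0$ be a probability measure on $\Theta$ (the prior), and let $L:\Theta\times\mathcal{Y}\to\mathbb{R}$ be a loss function. Assume: (a) $L$ is bounded from below on $\Theta\times\mathcal{Y}$; (b) there is a function $K$ such that $L(\theta,y)\le K(\|\theta\|,\|y\|)$ for all $\theta\in\Theta$, $y\in\mathcal{Y}$, and $(\theta,y)\mapsto K(\|\theta\|,\|y\|)$ belongs to $L^1(\rho_0\otimes P)$; (c) for every $r>0$ there is $C_1(r,\cdot)\in L^1(P)$, positive on $\mathcal{Y}$, such that $|L(\theta_1,y)-L(\theta_2,y)|\le C_1(r,y)\|\theta_1-\theta_2\|$ for all $y\in\mathcal{Y}$ and all $\theta_1,\theta_2\in\Theta$ with $\|\theta_1\|,\|\theta_2\|<r$; (d) for every $r>0$ there is $C_2(r,\cdot)\in L^1(\rho_0)$, positive on $\Theta$, such that $|L(\theta,y_1)-L(\theta,y_2)|\le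 C_2(r,\theta)\|y_1-y_2\|$ for all $\theta\in\Theta$ and all $y_1,y_2\in\mathcal{Y}$ with $\|y_1\|,\|y_2\|<r$; (e) $\rho_0$ has a Lebesgue density on $\Theta$ that is positive everywhere on $\Theta$ and whose logarithm is Lipschitz on $\{\theta\in\Theta:\|\theta\|<r\}$ for every $r>0$. Let $y_1,y_2,\dots$ be i.i.d. random variables with law $P$. For $W>0$ let the Gibbs posterior be $$\hat\rho_n^W(d\theta)=\frac{e^{-nWR_n(\theta)}\,\rho_0(d\theta)}{\int_\Theta e^{-nWR_n}\,d\rho_0},\qquad R_n(\theta)=\frac1n\sum_{i=1}^nL(\theta,y_i).$$ Let $R(\theta)=\int L(\theta,y)\,P(dy)$, and let $\Theta^*\subset\Theta$ be the set of minimizers of $R$ over $\Theta$. Then $\Theta^*$ is non-empty. Furthermore, let $\theta^*\in\Theta^*$, $r>0$ and $\bar W$ be such that $C_1(r,y)\,e^{\bar W L(\theta^*,y)}\in L^1(P)$. Then for every $W\in(0,\bar W)$ and every open set $U\supset\Theta^*$, $$\hat\rho_n^W(\Theta\setminus U)\to0\quad\text{as } n\to\infty,\ \text{with probability }1.$$ 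-/

import Mathlib

open MeasureTheory ProbabilityTheory Filter Topology

namespace GibbsPosterior

/-- The Euclidean space of dimension `k`. -/
abbrev Euc (k : ℕ) : Type := EuclideanSpace ℝ (Fin k)

/-- Standing assumptions on the loss `L : Θ × 𝒴 → ℝ` (only its values on `Θ × 𝒴` matter), where
`C₁ r y` is the Lipschitz constant in the parameter. -/
structure LossAssumption {m d : ℕ} (Θ : Set (Euc m)) (𝒴 : Set (Euc d))
    (ρ₀ : Measure (Euc m)) (P : Measure (Euc d))
    (L : Euc m → Euc d → ℝ) (C₁ : ℝ → Euc d → ℝ) : Prop where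
  /-- The loss is uniformly bounded from below. -/
  lower : ∃ B : ℝ, ∀ θ ∈ Θ, ∀ y ∈ 𝒴, B ≤ L θ y
  /-- The loss is dominated by an integrable function of the two norms. -/
  upper : ∃ K : ℝ → ℝ → ℝ,
    Integrable (fun z : Euc m × Euc d => K ‖z.1‖ ‖z.2‖) (ρ₀.prod P) ∧
      ∀ θ ∈ Θ, ∀ y ∈ 𝒴, L θ y ≤ K ‖θ‖ ‖y‖
  /-- The constants `C₁` are positive. -/
  lipschitz_par_pos : ∀ r : ℝ, 0 < r → ∀ y ∈ 𝒴, 0 < C₁ r y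
  /-- Local Lipschitz continuity in the parameter. -/
  lipschitz_par : ∀ r : ℝ, 0 < r → ∀ y ∈ 𝒴, ∀ θ₁ ∈ Θ, ∀ θ₂ ∈ Θ, ‖θ₁‖ < r → ‖θ₂‖ < r →
    |L θ₁ y - L θ₂ y| ≤ C₁ r y * ‖θ₁ - θ₂‖
  /-- The constants `C₁ r` are integrable. -/
  lipschitz_par_integrable : ∀ r : ℝ, 0 < r → Integrable (C₁ r) P
  /-- Local Lipschitz continuity in the data, with integrable constants. -/
  lipschitz_data : ∀ r : ℝ, 0 < r → ∃ C₂ : Euc m → ℝ,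
    (∀ θ ∈ Θ, 0 < C₂ θ) ∧ Integrable C₂ ρ₀ ∧
      ∀ θ ∈ Θ, ∀ y₁ ∈ 𝒴, ∀ y₂ ∈ 𝒴, ‖y₁‖ < r → ‖y₂‖ < r →
        |L θ y₁ - L θ y₂| ≤ C₂ θ * ‖y₁ - y₂‖

/-- The prior `ρ₀` has a Lebesgue density on `Θ` which is positive everywhere on `Θ` and whose
logarithm is Lipschitz on bounded subsets of `Θ`. -/
def PriorAssumption {m : ℕ} (Θ : Set (Euc m)) (ρ₀ : Measure (Euc m)) : Prop :=
  ∃ p : Euc m → ℝ,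
    ρ₀ = (volume.restrict Θ).withDensity (fun θ => ENNReal.ofReal (p θ)) ∧
    (∀ θ ∈ Θ, 0 < p θ) ∧
    ∀ r : ℝ, 0 < r → ∃ C₃ : ℝ, 0 < C₃ ∧ ∀ θ₁ ∈ Θ, ∀ θ₂ ∈ Θ, ‖θ₁‖ < r → ‖θ₂‖ < r →
      |Real.log (p θ₁) - Real.log (p θ₂)| ≤ C₃ * ‖θ₁ - θ₂‖

/-- The average loss `R_n(θ)` over the first `n` data points. -/
noncomputable def empiricalRisk {m d : ℕ} (L : Euc m → Euc d → ℝ) (y : ℕ → Euc d) (n : ℕ)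
    (θ : Euc m) : ℝ :=
  (1 / (n : ℝ)) * ∑ i ∈ Finset.range n, L θ (y i)

/-- The partition function `Z_n^W`. -/
noncomputable def partitionFunction {m d : ℕ} (ρ₀ : Measure (Euc m)) (L : Euc m → Euc d → ℝ)
    (W : ℝ) (y : ℕ → Euc d) (n : ℕ) : ℝ :=
  ∫ θ, Real.exp (-((n : ℝ) * W * empiricalRisk L y n θ)) ∂ρ₀

/-- The Gibbs posterior `exp(-n W R_n(θ)) ρ₀(dθ) / Z_n^W`. -/
noncomputable def gibbsPosterior {m d : ℕ} (ρ₀ : Measure (Euc m)) (L : Euc m → Euc d → ℝ)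
    (W : ℝ) (y : ℕ → Euc d) (n : ℕ) : Measure (Euc m) :=
  ρ₀.withDensity (fun θ => ENNReal.ofReal
    (Real.exp (-((n : ℝ) * W * empiricalRisk L y n θ)) / partitionFunction ρ₀ L W y n))

/-- The expected loss `R(θ) = ∫ L(θ, y) P(dy)`. -/
noncomputable def expectedRisk {m d : ℕ} (P : Measure (Euc d)) (L : Euc m → Euc d → ℝ)
    (θ : Euc m) : ℝ :=
  ∫ y, L θ y ∂P

/-- The set `Θ*` of minimizers over `Θ` of the expected loss. -/
def riskMinimizers {m d : ℕ} (Θ : Set (Euc m)) (P : Measure (Euc d))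
    (L : Euc m → Euc d → ℝ) : Set (Euc m) :=
  {θ | θ ∈ Θ ∧ ∀ θ' ∈ Θ, expectedRisk P L θ ≤ expectedRisk P L θ'}

end GibbsPosterior

/-! On the compact set Θ the Lipschitz bound makes R continuous, so a minimizer exists. The strong
law gives convergence of R_n at countably many dense θ and of the averages of C₁ over the data.
These averages are Lipschitz constants of R_n, hence eventually bounded, and a finite-net argument
makes R_n → R uniform on Θ almost surely.

The rest is Laplace's method. By compactness R exceeds its minimum by a fixed gap on Θ \ U, while
near θ* it is almost minimal on a set V of positive prior mass. Bounding the partition function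
below by its integral over V leaves a posterior mass of at most e^(-cn)/ρ₀(V) outside U, with c > 0.
-/

namespace GibbsPosterior

/-! ### Uniform law of large numbers -/

/-- Strong law of large numbers for averages of an integrable observable of i.i.d. data. -/
theorem ae_tendsto_average {E Ω : Type*} [MeasurableSpace E] [MeasurableSpace Ω]
    {P : Measure E} {μ : Measure Ω} {y : ℕ → Ω → E} (hy_meas : ∀ i, Measurable (y i))
    (hy_indep : iIndepFun y μ) (hy_law : ∀ i, μ.map (y i) = P) {g : E → ℝ}
    (hg : Integrable g P) :
    ∀ᵐ ω ∂μ, Tendsto (fun n : ℕ => (1 / (n : ℝ)) * ∑ i ∈ Finset.range n, g (y i ω)) atTop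
      (𝓝 (∫ v, g v ∂P)) := by
  -- Composition with the `y i` must preserve independence and law, so `g` is replaced by a
  -- measurable version; the exceptional set is null for the law of every `y i`.
  obtain ⟨g', hg', hgg'⟩ := hg.1
  have hgi : Integrable g' P := hg.congr hgg'
  have hae : ∀ᵐ ω ∂μ, ∀ i, g (y i ω) = g' (y i ω) := by
    rw [ae_all_iff]
    intro i
    have h := hgg'
    rw [← hy_law i] at h
    exact ae_of_ae_map (hy_meas i).aemeasurable h
  have hint : Integrable (fun ω => g' (y 0 ω)) μ := by
    rw [← hy_law 0] at hgi
    exact hgi.comp_measurable (hy_meas 0)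
  have hlim : ∫ ω, g' (y 0 ω) ∂μ = ∫ v, g v ∂P := by
    rw [integral_congr_ae hgg', ← hy_law 0,
      integral_map (hy_meas 0).aemeasurable hg'.aestronglyMeasurable]
  have hslln := strong_law_ae_real (μ := μ) (fun i ω => g' (y i ω)) hint
    (fun i j hij => (hy_indep.indepFun hij).comp hg'.measurable hg'.measurable)
    (fun i => IdentDistrib.comp
      ⟨(hy_meas i).aemeasurable, (hy_meas 0).aemeasurable, by rw [hy_law, hy_law]⟩ hg'.measurable)
  filter_upwards [hslln, hae] with ω h1 h2
  rw [← hlim]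
  refine h1.congr fun n => ?_
  simp only [h2]
  ring

/-- Convergence on a dense subset of a compact set is uniform for functions which are Lipschitz
with convergent constants. -/
theorem tendstoUniformlyOn_of_lipschitz {X : Type*} [PseudoMetricSpace X] {s t : Set X}
    (hs : IsCompact s) (hts : t ⊆ s) (hst : s ⊆ closure t) {f : ℕ → X → ℝ} {F : X → ℝ}
    {C : ℕ → ℝ} {c : ℝ} (hC : Tendsto C atTop (𝓝 c))
    (hf : ∀ n, ∀ x ∈ s, ∀ z ∈ s, |f n x - f n z| ≤ C n * dist x z)
    (hF : ∀ x ∈ s, ∀ z ∈ s, |F x - F z| ≤ c * dist x z)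
    (hlim : ∀ x ∈ t, Tendsto (fun n => f n x) atTop (𝓝 (F x))) :
    TendstoUniformlyOn f F atTop s := by
  rw [Metric.tendstoUniformlyOn_iff]
  intro ε hε
  -- `M` is positive, bounds `c` and eventually `C n`. On balls of radius `ε / (4 * M)` both `f n`
  -- and `F` vary by at most `ε / 4`, and the error at the centre is the third `ε / 4`.
  set M : ℝ := |c| + 1
  have hM : 0 < M := by positivity
  have hcM : c ≤ M := (le_abs_self c).trans (by simp [M])
  have hCM : ∀ᶠ n in atTop, C n ≤ M :=
    (hC.eventually_lt_const ((le_abs_self c).trans_lt (by simp [M]))).mono fun _ h => h.le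
  have hδ : 0 < ε / (4 * M) := by positivity
  obtain ⟨b, hbt, hbf, hsb⟩ := hs.elim_finite_subcover_image (b := t)
    (c := fun x => Metric.ball x (ε / (4 * M))) (fun _ _ => Metric.isOpen_ball) (by
      intro x hx
      obtain ⟨z, hz, hxz⟩ := Metric.mem_closure_iff.1 (hst hx) _ hδ
      exact Set.mem_biUnion hz hxz)
  have hb : ∀ᶠ n in atTop, ∀ z ∈ b, dist (f n z) (F z) < ε / 4 :=
    (Filter.eventually_all_finite hbf).2 fun z hz =>
      (Metric.tendsto_nhds.1 (hlim z (hbt hz))) _ (by positivity)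
  filter_upwards [hb, hCM] with n hn hCn x hx
  obtain ⟨z, hz, hxz⟩ := Set.mem_iUnion₂.1 (hsb hx)
  have hzs := hts (hbt hz)
  have hd : M * dist x z ≤ ε / 4 := by
    calc M * dist x z ≤ M * (ε / (4 * M)) := by gcongr; exact (Metric.mem_ball.1 hxz).le
      _ = ε / 4 := by field_simp
  have h1 := (hf n x hx z hzs).trans
    ((mul_le_mul_of_nonneg_right hCn dist_nonneg).trans hd)
  have h2 := (hF x hx z hzs).trans ((mul_le_mul_of_nonneg_right hcM dist_nonneg).trans hd)
  have h3 := hn z hz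
  rw [Real.dist_eq] at h3 ⊢
  rw [abs_lt] at h3 ⊢
  rw [abs_le] at h1 h2
  constructor <;> linarith

/-! ### Laplace's method -/

/-- Laplace principle: probability densities proportional to `exp (-n W f n)`, with `f n`
converging uniformly on a compact set, concentrate near the minimizers of the limit. -/
theorem tendsto_withDensity_exp_of_tendstoUniformlyOn {X : Type*} [PseudoMetricSpace X]
    [MeasurableSpace X] [BorelSpace X] {ρ : Measure X} [IsProbabilityMeasure ρ] {s U : Set X}
    (hs : IsCompact s) (hsm : MeasurableSet s) (hρs : ∀ᵐ x ∂ρ, x ∈ s)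
    {f : ℕ → X → ℝ} {F : X → ℝ}
    (hfc : ∀ n, ContinuousOn (f n) s) (hF : ContinuousOn F s)
    (hlim : TendstoUniformlyOn f F atTop s) {x₀ : X} (hx₀ : x₀ ∈ s)
    (hpos : ∀ ε : ℝ, 0 < ε → 0 < ρ (s ∩ Metric.ball x₀ ε))
    (hU : IsOpen U) (hmU : ∀ x ∈ s, F x ≤ F x₀ → x ∈ U) {W : ℝ} (hW : 0 < W) :
    Tendsto (fun n : ℕ => ρ.withDensity (fun x => ENNReal.ofReal
      (Real.exp (-((n : ℝ) * W * f n x)) / ∫ x, Real.exp (-((n : ℝ) * W * f n x)) ∂ρ)) (s \ U))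
      atTop (𝓝 0) := by
  rcases (s \ U).eq_empty_or_nonempty with hemp | hne
  · simp [hemp]
  obtain ⟨x₁, hx₁, hx₁min⟩ := (hs.diff hU).exists_isMinOn hne (hF.mono Set.sdiff_subset)
  have hgap : F x₀ < F x₁ := by
    by_contra! h
    exact hx₁.2 (hmU x₁ hx₁.1 h)
  -- A uniform error δ leaves `f n` above `F x₀ + 3δ` on `s \ U` and below `F x₀ + 2δ` near `x₀`;
  -- the remaining δ is the rate of decay.
  obtain ⟨δ, hδ, hδ'⟩ : ∃ δ > 0, F x₁ = F x₀ + 4 * δ := ⟨(F x₁ - F x₀) / 4, by linarith, by ring⟩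
  obtain ⟨ε, hε, hball⟩ := Metric.continuousOn_iff.1 hF x₀ hx₀ δ hδ
  set V : Set X := s ∩ Metric.ball x₀ ε
  have hVm : MeasurableSet V := hsm.inter Metric.isOpen_ball.measurableSet
  have hVF : ∀ x ∈ V, F x < F x₀ + δ := by
    intro x hx
    have := hball x hx.1 hx.2
    rw [Real.dist_eq, abs_lt] at this
    linarith
  have hVpos : 0 < ρ.real V := ENNReal.toReal_pos (hpos ε hε).ne' (measure_ne_top _ _)
  have hrestrict : ρ.restrict s = ρ := Measure.restrict_eq_self_of_ae_mem hρs
  have hint : ∀ n : ℕ, Integrable (fun x => Real.exp (-((n : ℝ) * W * f n x))) ρ := by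
    intro n
    rw [← hrestrict]
    exact ContinuousOn.integrableOn_compact' hs hsm
      (Real.continuous_exp.comp_continuousOn ((continuousOn_const.mul (hfc n)).neg))
  have hbound : ∀ᶠ n : ℕ in atTop, ρ.withDensity (fun x => ENNReal.ofReal
      (Real.exp (-((n : ℝ) * W * f n x)) / ∫ x, Real.exp (-((n : ℝ) * W * f n x)) ∂ρ)) (s \ U)
      ≤ ENNReal.ofReal (Real.exp (-((W * δ) * n)) / ρ.real V) := by
    filter_upwards [Metric.tendstoUniformlyOn_iff.1 hlim δ hδ] with n hn
    set Z := ∫ x, Real.exp (-((n : ℝ) * W * f n x)) ∂ρ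
    have hnW : 0 ≤ (n : ℝ) * W := by positivity
    have hZ : Real.exp (-((n : ℝ) * W * (F x₀ + 2 * δ))) * ρ.real V ≤ Z := by
      refine (setIntegral_ge_of_const_le_real hVm (measure_ne_top _ _) ?_
        (hint n).integrableOn).trans
        (setIntegral_le_integral (hint n) (ae_of_all _ fun _ => (Real.exp_pos _).le))
      intro x hx
      have h1 := hn x hx.1
      rw [Real.dist_eq, abs_lt] at h1
      have h2 := hVF x hx
      gcongr
      linarith
    have hZpos : 0 < Z := lt_of_lt_of_le (by positivity) hZ
    rw [withDensity_apply _ (hsm.diff hU.measurableSet)]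
    calc ∫⁻ x in s \ U, ENNReal.ofReal (Real.exp (-((n : ℝ) * W * f n x)) / Z) ∂ρ
        ≤ ∫⁻ x in s \ U, ENNReal.ofReal (Real.exp (-((W * δ) * n)) / ρ.real V) ∂ρ := by
          refine setLIntegral_mono measurable_const fun x hx => ENNReal.ofReal_le_ofReal ?_
          have h1 := hn x hx.1
          rw [Real.dist_eq, abs_lt] at h1
          have h2 : F x₁ ≤ F x := hx₁min hx
          rw [div_le_div_iff₀ hZpos hVpos]
          calc Real.exp (-((n : ℝ) * W * f n x)) * ρ.real V
              ≤ Real.exp (-((n : ℝ) * W * (F x₀ + 3 * δ))) * ρ.real V := by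
                gcongr
                linarith
            _ = Real.exp (-((W * δ) * n)) *
                (Real.exp (-((n : ℝ) * W * (F x₀ + 2 * δ))) * ρ.real V) := by
                rw [← mul_assoc, ← Real.exp_add]
                ring_nf
            _ ≤ Real.exp (-((W * δ) * n)) * Z := by gcongr
      _ ≤ ENNReal.ofReal (Real.exp (-((W * δ) * n)) / ρ.real V) := by
          rw [setLIntegral_const]
          exact mul_le_of_le_one_right' prob_le_one
  refine tendsto_of_tendsto_of_tendsto_of_le_of_le' tendsto_const_nhds ?_
    (Eventually.of_forall fun _ => zero_le) hbound
  have hexp : Tendsto (fun n : ℕ => Real.exp (-((W * δ) * n)) / ρ.real V) atTop (𝓝 0) := by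
    rw [← zero_div (ρ.real V)]
    refine Tendsto.div_const ?_ _
    exact Real.tendsto_exp_neg_atTop_nhds_zero.comp
      (tendsto_natCast_atTop_atTop.const_mul_atTop (by positivity))
  simpa using ENNReal.tendsto_ofReal hexp

/-! ### Consequences of the assumptions on prior and loss -/

/-- A function which is continuous on a set of full measure is a.e. strongly measurable, even if
the set is not measurable. -/
theorem _root_.ContinuousOn.aestronglyMeasurable_of_ae_mem {X : Type*} [TopologicalSpace X]
    [MeasurableSpace X] [BorelSpace X] {P : Measure X} {g : X → ℝ} {s : Set X}
    (hg : ContinuousOn g s) (hs : ∀ᵐ x ∂P, x ∈ s) : AEStronglyMeasurable g P := by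
  -- The complement of a measurable hull of `sᶜ` is a measurable subset of `s` of full measure.
  have htm : MeasurableSet (toMeasurable P sᶜ)ᶜ := (measurableSet_toMeasurable _ _).compl
  have hPt : ∀ᵐ x ∂P, x ∈ (toMeasurable P sᶜ)ᶜ :=
    measure_eq_zero_iff_ae_notMem.1 ((measure_toMeasurable _).trans hs)
  rw [← Measure.restrict_eq_self_of_ae_mem hPt]
  exact (hg.mono (Set.compl_subset_comm.1 (subset_toMeasurable P sᶜ))).aestronglyMeasurable htm

theorem PriorAssumption.ae_mem {m : ℕ} {Θ : Set (Euc m)} {ρ₀ : Measure (Euc m)}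
    (h : PriorAssumption Θ ρ₀) (hΘ : MeasurableSet Θ) : ∀ᵐ θ ∂ρ₀, θ ∈ Θ := by
  obtain ⟨p, rfl, -, -⟩ := h
  exact (withDensity_absolutelyContinuous _ _).ae_le (ae_restrict_mem hΘ)

/-- A Lipschitz logarithm on a bounded set keeps the density above a positive constant, so no
measurability of `p` is needed. -/
theorem PriorAssumption.measure_pos {m : ℕ} {Θ : Set (Euc m)} {ρ₀ : Measure (Euc m)}
    (h : PriorAssumption Θ ρ₀) (hΘ : IsCompact Θ) {A : Set (Euc m)} (hA : MeasurableSet A)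
    (hAΘ : A ⊆ Θ) (hpos : 0 < volume A) : 0 < ρ₀ A := by
  obtain ⟨p, rfl, hp, hlip⟩ := h
  obtain ⟨r, hr, hΘr⟩ := hΘ.isBounded.subset_ball_lt 0 0
  have hnorm : ∀ θ ∈ Θ, ‖θ‖ < r := fun θ hθ => by simpa using hΘr hθ
  obtain ⟨C, -, hC⟩ := hlip r hr
  obtain ⟨θ₀, hθ₀⟩ := nonempty_of_measure_ne_zero hpos.ne'
  have hlow : ∀ θ ∈ A, Real.exp (Real.log (p θ₀) - |C| * (r + r)) ≤ p θ := by
    intro θ hθ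
    rw [← Real.le_log_iff_exp_le (hp θ (hAΘ hθ))]
    have h1 := hC θ₀ (hAΘ hθ₀) θ (hAΘ hθ) (hnorm _ (hAΘ hθ₀)) (hnorm _ (hAΘ hθ))
    have h2 : ‖θ₀ - θ‖ ≤ r + r := (norm_sub_le _ _).trans
      (add_le_add (hnorm _ (hAΘ hθ₀)).le (hnorm _ (hAΘ hθ)).le)
    have h3 : C * ‖θ₀ - θ‖ ≤ |C| * (r + r) :=
      mul_le_mul (le_abs_self C) h2 (norm_nonneg _) (abs_nonneg _)
    linarith [(abs_le.1 h1).2]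
  rw [withDensity_apply _ hA, Measure.restrict_restrict_of_subset hAΘ]
  calc 0 < ENNReal.ofReal (Real.exp (Real.log (p θ₀) - |C| * (r + r))) * volume A :=
        ENNReal.mul_pos (by simp [Real.exp_pos]) hpos.ne'
    _ = ∫⁻ _ in A, ENNReal.ofReal (Real.exp (Real.log (p θ₀) - |C| * (r + r))) := by
        rw [setLIntegral_const]
    _ ≤ _ := setLIntegral_mono' hA fun θ hθ => ENNReal.ofReal_le_ofReal (hlow θ hθ)

section Loss

variable {m d : ℕ} {Θ : Set (Euc m)} {𝒴 : Set (Euc d)} {ρ₀ : Measure (Euc m)}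
  {P : Measure (Euc d)} {L : Euc m → Euc d → ℝ} {C₁ : ℝ → Euc d → ℝ}

/-- This is the source of measurability of the loss in the data. -/
theorem LossAssumption.continuousOn_data (hL : LossAssumption Θ 𝒴 ρ₀ P L C₁) {θ : Euc m}
    (hθ : θ ∈ Θ) : ContinuousOn (L θ) 𝒴 := by
  intro v hv
  obtain ⟨C₂, -, -, hC₂⟩ := hL.lipschitz_data (‖v‖ + 1) (by positivity)
  have hnear : ∀ᶠ v' in 𝓝[𝒴] v, ‖L θ v' - L θ v‖ ≤ C₂ θ * ‖v' - v‖ := by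
    filter_upwards [self_mem_nhdsWithin, mem_nhdsWithin_of_mem_nhds
      ((continuous_norm.tendsto v).eventually_lt_const (lt_add_one ‖v‖))] with v' hv' hlt
    exact hC₂ θ hθ v' hv' v hv hlt (lt_add_one _)
  refine tendsto_iff_norm_sub_tendsto_zero.2
    (squeeze_zero' (Eventually.of_forall fun _ => norm_nonneg _) hnear ?_)
  have hcont : Tendsto (fun v' => C₂ θ * ‖v' - v‖) (𝓝 v) (𝓝 (C₂ θ * ‖v - v‖)) :=
    (Continuous.tendsto (by fun_prop) v)
  simpa using hcont.mono_left nhdsWithin_le_nhds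

/-- Fubini makes the section of `K` integrable only for almost every θ; one such θ in Θ suffices. -/
theorem LossAssumption.exists_integrable [IsProbabilityMeasure ρ₀] [IsProbabilityMeasure P]
    (hL : LossAssumption Θ 𝒴 ρ₀ P L C₁) (hP : ∀ᵐ v ∂P, v ∈ 𝒴) (hΘ : ∀ᵐ θ ∂ρ₀, θ ∈ Θ) :
    ∃ θ ∈ Θ, Integrable (L θ) P := by
  obtain ⟨B, hB⟩ := hL.lower
  obtain ⟨K, hK, hLK⟩ := hL.upper
  obtain ⟨θ, hθ, hKθ⟩ := (hΘ.and hK.prod_right_ae).exists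
  refine ⟨θ, hθ, ((integrable_const |B|).add hKθ.norm).mono'
    ((hL.continuousOn_data hθ).aestronglyMeasurable_of_ae_mem hP) ?_⟩
  filter_upwards [hP] with v hv
  have h1 := hB θ hθ v hv
  have h2 := hLK θ hθ v hv
  rw [Real.norm_eq_abs, abs_le]
  simp only [Pi.add_apply, Real.norm_eq_abs]
  constructor
  · linarith [neg_abs_le B, abs_nonneg (K ‖θ‖ ‖v‖)]
  · linarith [abs_nonneg B, le_abs_self (K ‖θ‖ ‖v‖)]

/-- Integrability spreads from one parameter to all others, since differences of losses are
dominated by a multiple of `C₁ r`. -/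
theorem LossAssumption.integrable [IsProbabilityMeasure ρ₀] [IsProbabilityMeasure P]
    (hL : LossAssumption Θ 𝒴 ρ₀ P L C₁) (hP : ∀ᵐ v ∂P, v ∈ 𝒴) (hΘ : ∀ᵐ θ ∂ρ₀, θ ∈ Θ)
    {θ : Euc m} (hθ : θ ∈ Θ) : Integrable (L θ) P := by
  obtain ⟨θ₀, hθ₀, hint⟩ := hL.exists_integrable hP hΘ
  set r : ℝ := max ‖θ‖ ‖θ₀‖ + 1
  have hr : 0 < r := by positivity
  have hdiff : Integrable (fun v => L θ v - L θ₀ v) P := by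
    refine ((hL.lipschitz_par_integrable r hr).mul_const ‖θ - θ₀‖).mono'
      (((hL.continuousOn_data hθ).sub
        (hL.continuousOn_data hθ₀)).aestronglyMeasurable_of_ae_mem hP) ?_
    filter_upwards [hP] with v hv
    exact hL.lipschitz_par r hr v hv θ hθ θ₀ hθ₀ ((le_max_left _ _).trans_lt (lt_add_one _))
      ((le_max_right _ _).trans_lt (lt_add_one _))
  exact (hdiff.add hint).congr (ae_of_all _ fun v => by simp)

theorem LossAssumption.abs_expectedRisk_sub_le [IsProbabilityMeasure ρ₀] [IsProbabilityMeasure P]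
    (hL : LossAssumption Θ 𝒴 ρ₀ P L C₁) (hP : ∀ᵐ v ∂P, v ∈ 𝒴) (hΘ : ∀ᵐ θ ∂ρ₀, θ ∈ Θ)
    {r : ℝ} (hr : 0 < r) (hΘr : ∀ θ ∈ Θ, ‖θ‖ < r) :
    ∀ θ₁ ∈ Θ, ∀ θ₂ ∈ Θ, |expectedRisk P L θ₁ - expectedRisk P L θ₂|
      ≤ (∫ v, C₁ r v ∂P) * dist θ₁ θ₂ := by
  intro θ₁ h₁ θ₂ h₂
  rw [expectedRisk, expectedRisk, ← integral_sub (hL.integrable hP hΘ h₁)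
    (hL.integrable hP hΘ h₂), ← integral_mul_const, dist_eq_norm,
    ← Real.norm_eq_abs]
  refine norm_integral_le_of_norm_le ((hL.lipschitz_par_integrable r hr).mul_const _) ?_
  filter_upwards [hP] with v hv
  exact hL.lipschitz_par r hr v hv θ₁ h₁ θ₂ h₂ (hΘr _ h₁) (hΘr _ h₂)

theorem LossAssumption.abs_empiricalRisk_sub_le (hL : LossAssumption Θ 𝒴 ρ₀ P L C₁)
    {r : ℝ} (hr : 0 < r) (hΘr : ∀ θ ∈ Θ, ‖θ‖ < r) {y : ℕ → Euc d} (hy : ∀ i, y i ∈ 𝒴) (n : ℕ) :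
    ∀ θ₁ ∈ Θ, ∀ θ₂ ∈ Θ, |empiricalRisk L y n θ₁ - empiricalRisk L y n θ₂|
      ≤ ((1 / (n : ℝ)) * ∑ i ∈ Finset.range n, C₁ r (y i)) * dist θ₁ θ₂ := by
  intro θ₁ h₁ θ₂ h₂
  rw [empiricalRisk, empiricalRisk, ← mul_sub, ← Finset.sum_sub_distrib, abs_mul,
    abs_of_nonneg (by positivity : (0 : ℝ) ≤ 1 / n), mul_assoc, Finset.sum_mul, dist_eq_norm]
  gcongr
  refine (Finset.abs_sum_le_sum_abs _ _).trans (Finset.sum_le_sum fun i _ => ?_)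
  exact hL.lipschitz_par r hr _ (hy i) θ₁ h₁ θ₂ h₂ (hΘr _ h₁) (hΘr _ h₂)

end Loss

theorem continuousOn_of_abs_sub_le_mul_dist {X : Type*} [PseudoMetricSpace X] {s : Set X}
    {f : X → ℝ} {c : ℝ} (hf : ∀ x ∈ s, ∀ z ∈ s, |f x - f z| ≤ c * dist x z) :
    ContinuousOn f s :=
  (LipschitzOnWith.of_dist_le_mul (K := c.toNNReal) fun x hx z hz => (hf x hx z hz).trans
    (mul_le_mul_of_nonneg_right (Real.le_coe_toNNReal c) dist_nonneg)).continuousOn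

end GibbsPosterior

/-! ### Posterior concentration -/

theorem theorem4 {m d : ℕ}
    (Θ : Set (GibbsPosterior.Euc m)) (𝒴 : Set (GibbsPosterior.Euc d))
    (ρ₀ : Measure (GibbsPosterior.Euc m)) [IsProbabilityMeasure ρ₀]
    (P : Measure (GibbsPosterior.Euc d)) [IsProbabilityMeasure P]
    (hP : ∀ᵐ y ∂P, y ∈ 𝒴)
    (L : GibbsPosterior.Euc m → GibbsPosterior.Euc d → ℝ)
    (C₁ : ℝ → GibbsPosterior.Euc d → ℝ)
    (hL : GibbsPosterior.LossAssumption Θ 𝒴 ρ₀ P L C₁)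
    (hρ₀ : GibbsPosterior.PriorAssumption Θ ρ₀)
    (hΘ : ∀ θ ∈ Θ, ∀ ε : ℝ, 0 < ε → 0 < volume (Θ ∩ Metric.ball θ ε))
    (hΘc : IsCompact Θ)
    {Ω : Type*} [MeasurableSpace Ω] (μ : Measure Ω) [IsProbabilityMeasure μ]
    (y : ℕ → Ω → GibbsPosterior.Euc d)
    (hy_meas : ∀ i, Measurable (y i))
    (hy_indep : iIndepFun y μ)
    (hy_law : ∀ i, μ.map (y i) = P) :
    (GibbsPosterior.riskMinimizers Θ P L).Nonempty ∧
    ∀ r : ℝ, 0 < r →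
    ∀ θstar ∈ GibbsPosterior.riskMinimizers Θ P L,
    ∀ Wbar : ℝ, Integrable (fun v => C₁ r v * Real.exp (Wbar * L θstar v)) P →
    ∀ W : ℝ, 0 < W → W < Wbar →
    ∀ U : Set (GibbsPosterior.Euc m), IsOpen U → GibbsPosterior.riskMinimizers Θ P L ⊆ U →
      ∀ᵐ ω ∂μ, Tendsto
        (fun n : ℕ => GibbsPosterior.gibbsPosterior ρ₀ L W (fun i => y i ω) n (Θ \ U))
        atTop (𝓝 0) := by
  have hΘm : MeasurableSet Θ := hΘc.measurableSet
  have hρΘ : ∀ᵐ θ ∂ρ₀, θ ∈ Θ := hρ₀.ae_mem hΘm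
  -- A radius enclosing all of Θ turns the local Lipschitz bounds into global ones.
  obtain ⟨r₀, hr₀, hΘball⟩ := hΘc.isBounded.subset_ball_lt 0 0
  have hΘr : ∀ θ ∈ Θ, ‖θ‖ < r₀ := fun θ hθ => by simpa using hΘball hθ
  have hRlip := hL.abs_expectedRisk_sub_le hP hρΘ hr₀ hΘr
  have hRcont := GibbsPosterior.continuousOn_of_abs_sub_le_mul_dist hRlip
  refine ⟨?_, ?_⟩
  · obtain ⟨θ, hθ, hmin⟩ := hΘc.exists_isMinOn hρΘ.exists hRcont
    exact ⟨θ, hθ, fun θ' hθ' => hmin hθ'⟩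
  intro r _ θstar hθstar Wbar _ W hW _ U hU hΘU
  -- The null set in the strong law depends on θ; countability of `D` keeps the union null.
  obtain ⟨D, hDΘ, hDc, hΘD⟩ :=
    (TopologicalSpace.IsSeparable.of_separableSpace Θ).exists_countable_dense_subset
  have hydata : ∀ᵐ ω ∂μ, ∀ i, y i ω ∈ 𝒴 := by
    rw [ae_all_iff]
    intro i
    have h := hP
    rw [← hy_law i] at h
    exact ae_of_ae_map (hy_meas i).aemeasurable h
  have hrisk : ∀ᵐ ω ∂μ, ∀ θ ∈ D, Tendsto
      (fun n => GibbsPosterior.empiricalRisk L (fun i => y i ω) n θ) atTop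
      (𝓝 (GibbsPosterior.expectedRisk P L θ)) :=
    (ae_ball_iff hDc).2 fun θ hθ => GibbsPosterior.ae_tendsto_average hy_meas hy_indep hy_law
      (hL.integrable hP hρΘ (hDΘ hθ))
  filter_upwards [hydata, hrisk, GibbsPosterior.ae_tendsto_average hy_meas hy_indep hy_law
    (hL.lipschitz_par_integrable r₀ hr₀)] with ω hω hlim hC
  have hlip := hL.abs_empiricalRisk_sub_le hr₀ hΘr hω
  refine GibbsPosterior.tendsto_withDensity_exp_of_tendstoUniformlyOn hΘc hΘm hρΘ
    (fun n => GibbsPosterior.continuousOn_of_abs_sub_le_mul_dist (hlip n)) hRcont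
    (GibbsPosterior.tendstoUniformlyOn_of_lipschitz hΘc hDΘ hΘD hC hlip hRlip hlim)
    hθstar.1 (fun ε hε => hρ₀.measure_pos hΘc
      (hΘm.inter Metric.isOpen_ball.measurableSet) Set.inter_subset_left
      (hΘ θstar hθstar.1 ε hε)) hU
    (fun θ hθ hle => hΘU ⟨hθ, fun θ' hθ' => hle.trans (hθstar.2 θ' hθ')⟩) hW
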